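/- Let $\mathcal X$ be a measurable space with a dominating ($\sigma$-finite) measure $\mathrm dx$, and let $\pi_0$ (reference) and $\pi$ (target) be probability distributions on $\mathcal X$ with strictly positive densities, also denoted $\pi_0,\pi$, with respect to $\mathrm dx$. Put $L(x)=\pi(x)/\pi_0(x)$, $V(x)=-\log L(x)$, and for $\beta\in[0,1]$ let $\pi^{(\beta)}(x)=L(x)^\beta\pi_0(x)/\mathcal Z(\beta)$ with $\mathcal Z(\beta)=\int_{\mathcal X} L(x)^\beta\pi_0(x)\,\mathrm dx$. Let $V^{(\beta)}$ denote a random variable distributed as $V(X^{(\beta)})$ with $X^{(\beta)}\sim\pi^{(\beta)}$. Define $$r(\beta,\beta')=1-\mathbb E\left[\exp\left(\min\{0,(\beta'-\beta)(V^{(\beta')}-V^{(\beta)})\}\right)\right]$$ with $V^{(\beta)},V^{(\beta')}$ independent, the local communication barrier $$\lambda(\beta)=\lim_{\delta\to0,\ \delta\neq 0,\ \beta+\delta\in[0,1]}\frac{r(\beta,\beta+\delta)}{|\delta|},$$ and the global communication barrier $\Lambda=\int_0^1\lambda(\beta)\,\mathrm d\beta$. Assume that $V^3$ is integrable with respect to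 $\pi_0$ and $\pi$. For $d\in\mathbb N$ let $\lambda_d$ and $\Lambda_d$ be the local and global communication barriers defined in the same way on $\mathcal X^d$, with the product measure as dominating measure, for the reference $\pi_{0,d}(x)=\prod_{i=1}^d\pi_0(x_i)$ and the target $\pi_d(x)=\prod_{i=1}^d\pi(x_i)$. Let $\sigma^2(\beta)=\mathrm{Var}(V^{(\beta)})$, where $V^{(\beta)}$ refers to the one-coordinate pair $(\pi_0,\pi)$. Then the limits defining $\lambda_d(\beta)$ exist for all $d$ and $\beta\in[0,1]$, $\lambda_d$ is integrable on $[0,1]$, $\sigma^2(\beta)<\infty$ for all $\beta\in[0,1]$, $\sigma$ is integrable on $[0,1]$, and as $d\to\infty$, $$\lambda_d(\beta)\sim\sqrt{\frac d{\boldsymbol\pi}}\,\sigma(\beta)\quad\text{for every }\beta\in[0,1],\qquad \Lambda_d\sim\sqrt{\frac d{\boldsymbol\pi}}\int_0^1\sigma(\beta)\,\mathrm d\beta,$$ where $\boldsymbol\pi=3.14159\ldots$ and $a_d\sim b_d$ means $a_d-b_d=o(b_d)$ (so $a_d=0$ for all large $d$ if $b_d=0$ for all large $d$). Hence $\lambda_d(\beta)=O(\sqrt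 d)$ for every $\beta\in[0,1]$ and $\Lambda_d=O(\sqrt d)$; and if $\pi_0\neq\pi$ as distributions, then $\lambda_d(\beta)=\Theta(\sqrt d)$ for every $\beta\in[0,1]$ and $\Lambda_d=\Theta(\sqrt d)$. -/

import Mathlib

open Filter Topology MeasureTheory ProbabilityTheory Set Asymptotics

namespace Tempering

noncomputable section

/-- The distribution with density `p` with respect to the dominating measure `ν`. -/
def densityMeasure {X : Type*} [MeasurableSpace X] (ν : Measure X) (p : X → ℝ) : Measure X :=
  ν.withDensity (fun x => ENNReal.ofReal (p x))

/-- The likelihood ratio `L = π / π₀` of the target density `p` and the reference density `p₀`. -/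
def likelihood {X : Type*} (p₀ p : X → ℝ) (x : X) : ℝ := p x / p₀ x

/-- The energy `V = -log L`. -/
def energy {X : Type*} (p₀ p : X → ℝ) (x : X) : ℝ := -Real.log (likelihood p₀ p x)

/-- The normalizing constant `Z(β) = ∫ L(x)^β π₀(x) dx`. -/
def normalizer {X : Type*} [MeasurableSpace X] (ν : Measure X) (p₀ p : X → ℝ) (β : ℝ) : ℝ :=
  ∫ x, likelihood p₀ p x ^ β * p₀ x ∂ν

/-- The annealed distribution `π^(β)`, with density `L(x)^β π₀(x) / Z(β)`. -/
def annealed {X : Type*} [MeasurableSpace X] (ν : Measure X) (p₀ p : X → ℝ) (β : ℝ) : Measure X :=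
  densityMeasure ν (fun x => likelihood p₀ p x ^ β * p₀ x / normalizer ν p₀ p β)

/-- The swap probability
`s(β,β') = E[exp(min{0, (β' - β)(V^(β') - V^(β))})]`, where `V^(β)` and `V^(β')` are independent,
realised on the product of the annealed distributions. -/
def swapProb {X : Type*} [MeasurableSpace X] (ν : Measure X) (p₀ p : X → ℝ) (β β' : ℝ) : ℝ :=
  ∫ z : X × X, Real.exp (min 0 ((β' - β) * (energy p₀ p z.2 - energy p₀ p z.1)))
    ∂((annealed ν p₀ p β).prod (annealed ν p₀ p β'))

/-- The rejection probability `r(β,β') = 1 - s(β,β')`. -/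
def rejectionProb {X : Type*} [MeasurableSpace X] (ν : Measure X) (p₀ p : X → ℝ) (β β' : ℝ) : ℝ :=
  1 - swapProb ν p₀ p β β'

/-- The filter `δ → 0`, through nonzero `δ` for which `β + δ` is an annealing parameter. -/
def increments (β : ℝ) : Filter ℝ := 𝓝[{δ : ℝ | δ ≠ 0 ∧ β + δ ∈ Icc (0 : ℝ) 1}] 0

/-- The local communication barrier `λ(β) = lim_{δ → 0} r(β, β + δ) / |δ|`. -/
def localBarrier {X : Type*} [MeasurableSpace X] (ν : Measure X) (p₀ p : X → ℝ) (β : ℝ) : ℝ :=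
  limUnder (increments β) (fun δ => rejectionProb ν p₀ p β (β + δ) / |δ|)

/-- The global communication barrier `Λ = ∫₀¹ λ(β) dβ`. -/
def globalBarrier {X : Type*} [MeasurableSpace X] (ν : Measure X) (p₀ p : X → ℝ) : ℝ :=
  ∫ β in (0 : ℝ)..1, localBarrier ν p₀ p β

/-- `σ(β)`, the standard deviation of `V^(β)`. -/
def energyStd {X : Type*} [MeasurableSpace X] (ν : Measure X) (p₀ p : X → ℝ) (β : ℝ) : ℝ :=
  Real.sqrt (variance (energy p₀ p) (annealed ν p₀ p β))

/-- The product dominating measure on `X^d`. -/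
def prodBase {X : Type*} [MeasurableSpace X] (ν : Measure X) (d : ℕ) : Measure (Fin d → X) :=
  Measure.pi (fun _ => ν)

/-- The product density `∏ᵢ p(xᵢ)` on `X^d`. -/
def prodDensity {X : Type*} (p : X → ℝ) (d : ℕ) (x : Fin d → X) : ℝ := ∏ i, p (x i)

/-- The local communication barrier `λ_d` between `∏ᵢ π₀(xᵢ)` and `∏ᵢ π(xᵢ)`. -/
def localBarrierDim {X : Type*} [MeasurableSpace X] (ν : Measure X) (p₀ p : X → ℝ) (d : ℕ)
    (β : ℝ) : ℝ :=
  localBarrier (prodBase ν d) (prodDensity p₀ d) (prodDensity p d) β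

/-- The global communication barrier `Λ_d` between `∏ᵢ π₀(xᵢ)` and `∏ᵢ π(xᵢ)`. -/
def globalBarrierDim {X : Type*} [MeasurableSpace X] (ν : Measure X) (p₀ p : X → ℝ) (d : ℕ) : ℝ :=
  globalBarrier (prodBase ν d) (prodDensity p₀ d) (prodDensity p d)

end

end Tempering

/-!
The rejection probability `r(β, β')` is a total variation distance: the joint density of the two
replicas times the acceptance probability is the minimum of the joint density and its image under
the swap (`one_sub_integral_exp_min`). Hence
`r(β, β') = (2 Z(β) Z(β'))⁻¹ ∫∫ |e^{-β'u - βv} - e^{-βu - β'v}|`, where `u`, `v` are the energies of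
two independent draws from the reference. The difference quotients in `β'` are dominated by
`|u - v| (1 + e^{-u}) (1 + e^{-v})`, which is integrable when the energy is integrable under reference
and target. The local barrier is therefore half the mean absolute difference `E|V - V'| / 2` of two
independent energies at inverse temperature `β` (`tendsto_rejection_div`), and it is continuous in
`β` on `[0, 1]`.

Annealing commutes with products (`IsIntegrablePair.annealed_prod`), so on `X^d` the energy
difference is a sum of `d` independent copies of `V - V'`, which is centred with variance
`2 σ(β)²`. The central limit theorem, with the bounded second moments as the source of uniform
integrability, gives `E|∑ᵢ (Vᵢ - Vᵢ')| / √d → √2 σ(β) √(2 / π)` (`tendsto_integral_abs_sum`), and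
half of this is `σ(β) / √π`. Jensen's inequality bounds the local barrier by `√d σ(β)`
(`IsIntegrablePair.localBarrierDim_le`); since `σ` is continuous on `[0, 1]`, dominated convergence
carries the limit over to the global barrier.

If `σ(β) = 0` at some `β`, the energy is almost surely constant, and normalisation forces reference
and target to agree (`IsIntegrablePair.energyStd_pos`); otherwise `σ` is positive and the growth is
exactly of order `√d`. In the degenerate case the equivalences hold because the barriers vanish.
-/

namespace Tempering

/-! ### Exponential tilts along an interval of inverse temperatures -/

/-- On `[0, 1]` the exponential weights have a bound that does not depend on `β`, which is integrable
as soon as the weights at `β = 0` and `β = 1` are. -/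
lemma exp_neg_mul_le {β : ℝ} (hβ : β ∈ Icc (0 : ℝ) 1) (u : ℝ) :
    Real.exp (-β * u) ≤ 1 + Real.exp (-u) := by
  rcases le_total 0 u with h | h
  · have : Real.exp (-β * u) ≤ Real.exp 0 :=
      Real.exp_le_exp.2 (by nlinarith [mul_nonneg hβ.1 h])
    rw [Real.exp_zero] at this
    linarith [Real.exp_pos (-u)]
  · have : Real.exp (-β * u) ≤ Real.exp (-u) :=
      Real.exp_le_exp.2 (by nlinarith [mul_nonneg (sub_nonneg.2 hβ.2) (neg_nonneg.2 h)])
    linarith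

lemma abs_exp_sub_exp_le (a b : ℝ) :
    |Real.exp a - Real.exp b| ≤ |a - b| * max (Real.exp a) (Real.exp b) := by
  wlog h : b ≤ a generalizing a b
  · rw [abs_sub_comm, abs_sub_comm a, max_comm]
    exact this b a (le_of_not_ge h)
  have he := Real.exp_le_exp.2 h
  rw [max_eq_left he, abs_of_nonneg (sub_nonneg.2 he), abs_of_nonneg (sub_nonneg.2 h)]
  have h1 := Real.add_one_le_exp (b - a)
  have h2 : Real.exp b = Real.exp a * Real.exp (b - a) := by rw [← Real.exp_add]; ring_nf
  rw [h2]
  nlinarith [Real.exp_pos a]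

section Tilt

variable {E : Type*} [MeasurableSpace E] {P : Measure E} {U : E → ℝ}

lemma integrable_exp_neg_mul_mul (hU : Measurable U) {g : E → ℝ}
    (hg : Integrable g P) (hg' : Integrable (fun x => Real.exp (-U x) * g x) P) {β : ℝ}
    (hβ : β ∈ Icc (0 : ℝ) 1) :
    Integrable (fun x => Real.exp (-β * U x) * g x) P := by
  refine (hg.norm.add hg'.norm).mono'
    ((by fun_prop : Measurable fun x => Real.exp (-β * U x)).aestronglyMeasurable.mul
      hg.aestronglyMeasurable) (ae_of_all _ fun x => ?_)
  simp only [Pi.add_apply, norm_mul, Real.norm_eq_abs, Real.abs_exp]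
  nlinarith [exp_neg_mul_le hβ (U x), abs_nonneg (g x)]

lemma continuousOn_integral_exp_neg_mul (hU : Measurable U) {g : E → ℝ}
    (hg : Integrable g P) (hg' : Integrable (fun x => Real.exp (-U x) * g x) P) :
    ContinuousOn (fun β : ℝ => ∫ x, Real.exp (-β * U x) * g x ∂P) (Icc 0 1) := by
  intro β hβ
  refine continuousWithinAt_of_dominated (bound := fun x => |g x| + |Real.exp (-U x) * g x|)
    ?_ ?_ (hg.norm.add hg'.norm) ?_
  · filter_upwards [self_mem_nhdsWithin] with b hb
    exact (integrable_exp_neg_mul_mul hU hg hg' hb).aestronglyMeasurable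
  · filter_upwards [self_mem_nhdsWithin] with b hb
    refine ae_of_all _ fun x => ?_
    simp only [norm_mul, Real.norm_eq_abs, abs_mul, Real.abs_exp]
    nlinarith [exp_neg_mul_le hb (U x), abs_nonneg (g x)]
  · exact ae_of_all _ fun x => (by fun_prop : Continuous fun b : ℝ =>
      Real.exp (-b * U x) * g x).continuousWithinAt

lemma integral_tilted_eq_div (f g : E → ℝ) :
    ∫ x, g x ∂(P.tilted f) = (∫ x, Real.exp (f x) * g x ∂P) / ∫ x, Real.exp (f x) ∂P := by
  rw [integral_tilted, ← integral_div]
  refine integral_congr_ae (ae_of_all _ fun x => ?_)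
  simp only [smul_eq_mul]
  ring

variable [IsProbabilityMeasure P]

lemma integrable_exp_neg_mul (hU : Measurable U) (hexp : Integrable (fun x => Real.exp (-U x)) P)
    {β : ℝ} (hβ : β ∈ Icc (0 : ℝ) 1) : Integrable (fun x => Real.exp (-β * U x)) P := by
  simpa using integrable_exp_neg_mul_mul hU (integrable_const (1 : ℝ)) (by simpa using hexp) hβ

lemma integral_exp_neg_mul_pos (hU : Measurable U)
    (hexp : Integrable (fun x => Real.exp (-U x)) P) {β : ℝ} (hβ : β ∈ Icc (0 : ℝ) 1) :
    0 < ∫ x, Real.exp (-β * U x) ∂P :=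
  integral_exp_pos (integrable_exp_neg_mul hU hexp hβ)

lemma continuousOn_integral_tilted (hU : Measurable U)
    (hexp : Integrable (fun x => Real.exp (-U x)) P) {g : E → ℝ}
    (hg : Integrable g P) (hg' : Integrable (fun x => Real.exp (-U x) * g x) P) :
    ContinuousOn (fun β : ℝ => ∫ x, g x ∂(P.tilted fun x => -β * U x)) (Icc 0 1) := by
  simp_rw [integral_tilted_eq_div]
  refine (continuousOn_integral_exp_neg_mul hU hg hg').div ?_
    fun β hβ => (integral_exp_neg_mul_pos hU hexp hβ).ne'
  simpa using continuousOn_integral_exp_neg_mul hU (g := fun _ => 1) (integrable_const (1 : ℝ))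
    (by simpa using hexp)

end Tilt

/-- A product of exponential tilts is the tilt of the product by the sum of the exponents. -/
lemma tilted_prod_tilted {E F : Type*} [MeasurableSpace E] [MeasurableSpace F] (P : Measure E)
    (Q : Measure F) [SFinite P] [SFinite Q] {f : E → ℝ} {g : F → ℝ} (hf : Measurable f)
    (hg : Measurable g) :
    (P.tilted f).prod (Q.tilted g) = (P.prod Q).tilted (fun z => f z.1 + g z.2) := by
  unfold Measure.tilted
  rw [prod_withDensity (by fun_prop) (by fun_prop)]
  congr 1
  ext z
  simp_rw [Real.exp_add]
  rw [integral_prod_mul (fun x => Real.exp (f x)) (fun y => Real.exp (g y)), mul_div_mul_comm,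
    ENNReal.ofReal_mul (div_nonneg (Real.exp_pos _).le
      (integral_nonneg fun x => (Real.exp_pos _).le))]

/-! ### The local communication barrier of a tilted pair -/

section Swap

variable {E : Type*} [MeasurableSpace E] {P : Measure E} {V : E → ℝ} [IsProbabilityMeasure P]

/-- The rejection probability is the total variation distance between the joint laws of the two
replicas before and after the swap: with `A`, `B` the two unnormalised joint densities, the swap
probability is `∫ min A B / (Z Z')`, and `min A B = (A + B - |A - B|) / 2`. -/
lemma one_sub_integral_exp_min (hVm : Measurable V)
    (hexp : Integrable (fun x => Real.exp (-V x)) P) {β β' : ℝ} (hβ : β ∈ Icc (0 : ℝ) 1)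
    (hβ' : β' ∈ Icc (0 : ℝ) 1) :
    1 - ∫ z : E × E, Real.exp (min 0 ((β' - β) * (V z.2 - V z.1)))
        ∂((P.tilted fun x => -β * V x).prod (P.tilted fun x => -β' * V x)) =
      (∫ z : E × E, |Real.exp (-β' * V z.1 + -β * V z.2) - Real.exp (-β * V z.1 + -β' * V z.2)|
        ∂(P.prod P)) /
        (2 * ((∫ x, Real.exp (-β * V x) ∂P) * ∫ x, Real.exp (-β' * V x) ∂P)) := by
  set Z := ∫ x, Real.exp (-β * V x) ∂P with hZ
  set Z' := ∫ x, Real.exp (-β' * V x) ∂P with hZ'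
  have hZpos : 0 < Z := integral_exp_neg_mul_pos hVm hexp hβ
  have hZpos' : 0 < Z' := integral_exp_neg_mul_pos hVm hexp hβ'
  have hi := integrable_exp_neg_mul hVm hexp hβ
  have hi' := integrable_exp_neg_mul hVm hexp hβ'
  have hA : Integrable (fun z : E × E => Real.exp (-β * V z.1 + -β' * V z.2)) (P.prod P) := by
    simpa only [Real.exp_add] using hi.mul_prod hi'
  have hB : Integrable (fun z : E × E => Real.exp (-β' * V z.1 + -β * V z.2)) (P.prod P) := by
    simpa only [Real.exp_add] using hi'.mul_prod hi
  have hAint : ∫ z : E × E, Real.exp (-β * V z.1 + -β' * V z.2) ∂(P.prod P) = Z * Z' := by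
    simp_rw [Real.exp_add]
    exact integral_prod_mul (fun x => Real.exp (-β * V x)) (fun x => Real.exp (-β' * V x))
  have hBint : ∫ z : E × E, Real.exp (-β' * V z.1 + -β * V z.2) ∂(P.prod P) = Z * Z' := by
    simp_rw [Real.exp_add]
    rw [mul_comm Z]
    exact integral_prod_mul (fun x => Real.exp (-β' * V x)) (fun x => Real.exp (-β * V x))
  rw [tilted_prod_tilted P P (by fun_prop) (by fun_prop), integral_tilted_eq_div, hAint]
  -- The product of the joint density and the acceptance probability is symmetric in the replicas.
  have hmin : ∀ z : E × E, Real.exp (-β * V z.1 + -β' * V z.2) *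
      Real.exp (min 0 ((β' - β) * (V z.2 - V z.1))) =
      (Real.exp (-β * V z.1 + -β' * V z.2) + Real.exp (-β' * V z.1 + -β * V z.2)) / 2
      - |Real.exp (-β' * V z.1 + -β * V z.2) - Real.exp (-β * V z.1 + -β' * V z.2)| / 2 := by
    intro z
    have e : -β' * V z.1 + -β * V z.2
        = -β * V z.1 + -β' * V z.2 + (β' - β) * (V z.2 - V z.1) := by ring
    rw [← Real.exp_add]
    rcases le_total 0 ((β' - β) * (V z.2 - V z.1)) with h | h
    · rw [min_eq_left h, add_zero, abs_of_nonneg (sub_nonneg.2 (Real.exp_le_exp.2 (by linarith)))]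
      ring
    · rw [min_eq_right h, ← e,
        abs_of_nonpos (sub_nonpos.2 (Real.exp_le_exp.2 (by linarith)))]
      ring
  simp_rw [hmin]
  have hsplit := integral_sub ((hA.add hB).div_const 2) ((hB.sub hA).abs.div_const 2)
  simp only [Pi.add_apply, Pi.sub_apply] at hsplit
  rw [hsplit, integral_div, integral_div, integral_add hA hB, hAint, hBint]
  have hring : ∀ I : ℝ, 1 - ((Z * Z' + Z * Z') / 2 - I / 2) / (Z * Z') = I / (2 * (Z * Z')) := by
    intro I
    field_simp
    ring
  exact hring _

/-- Integrability of the function that dominates the difference quotients of the rejection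
probability. -/
lemma integrable_abs_sub_mul (hV : Integrable V P)
    (hexp : Integrable (fun x => Real.exp (-V x)) P)
    (hVexp : Integrable (fun x => Real.exp (-V x) * V x) P) :
    Integrable (fun z : E × E => |V z.1 - V z.2| *
      ((1 + Real.exp (-V z.1)) * (1 + Real.exp (-V z.2)))) (P.prod P) := by
  have h1 : Integrable (fun x => |V x| * (1 + Real.exp (-V x))) P := by
    refine (hV.abs.add hVexp.abs).congr (ae_of_all _ fun x => ?_)
    simp only [Pi.add_apply, abs_mul, Real.abs_exp]
    ring
  have h2 : Integrable (fun x => 1 + Real.exp (-V x)) P := (integrable_const 1).add hexp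
  refine ((h1.mul_prod h2).add (h2.mul_prod h1)).mono' ?_ (ae_of_all _ fun z => ?_)
  · have hc1 := hV.aestronglyMeasurable.comp_fst (ν := P)
    have hc2 := hV.aestronglyMeasurable.comp_snd (μ := P)
    have he1 := h2.aestronglyMeasurable.comp_fst (ν := P)
    have he2 := h2.aestronglyMeasurable.comp_snd (μ := P)
    exact (hc1.sub hc2).norm.mul (he1.mul he2)
  · have hp : 0 < (1 + Real.exp (-V z.1)) * (1 + Real.exp (-V z.2)) := by positivity
    simp only [Pi.add_apply, norm_mul, Real.norm_eq_abs, abs_abs]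
    rw [← abs_mul, abs_of_pos hp]
    nlinarith [abs_sub (V z.1) (V z.2)]

/-- The local communication barrier is half the mean absolute difference of two independent
energies: the limit is taken under the integral sign. -/
lemma tendsto_rejection_div (hVm : Measurable V) (hV : Integrable V P)
    (hexp : Integrable (fun x => Real.exp (-V x)) P)
    (hVexp : Integrable (fun x => Real.exp (-V x) * V x) P) {β : ℝ} (hβ : β ∈ Icc (0 : ℝ) 1) :
    Tendsto (fun δ : ℝ => (1 - ∫ z : E × E, Real.exp (min 0 ((β + δ - β) * (V z.2 - V z.1)))
        ∂((P.tilted fun x => -β * V x).prod (P.tilted fun x => -(β + δ) * V x))) / |δ|)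
      (increments β)
      (𝓝 ((∫ z : E × E, |V z.1 - V z.2|
        ∂((P.tilted fun x => -β * V x).prod (P.tilted fun x => -β * V x))) / 2)) := by
  have hmem : ∀ᶠ δ in increments β, δ ≠ 0 ∧ β + δ ∈ Icc (0 : ℝ) 1 := self_mem_nhdsWithin
  have hZcont : Tendsto (fun δ : ℝ => ∫ x, Real.exp (-(β + δ) * V x) ∂P) (increments β)
      (𝓝 (∫ x, Real.exp (-β * V x) ∂P)) := by
    have h := continuousOn_integral_exp_neg_mul (P := P) hVm (g := fun _ => 1)
      (integrable_const (1 : ℝ)) (by simpa using hexp) β hβ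
    simp only [mul_one] at h
    refine h.tendsto.comp (tendsto_nhdsWithin_iff.2 ⟨?_, hmem.mono fun δ hδ => hδ.2⟩)
    have : Tendsto (fun δ : ℝ => β + δ) (𝓝 0) (𝓝 (β + 0)) := by
      exact (continuous_const.add continuous_id).tendsto 0
    rw [add_zero] at this
    exact this.mono_left nhdsWithin_le_nhds
  have hnum : Tendsto (fun δ : ℝ => ∫ z : E × E, |Real.exp (-(β + δ) * V z.1 + -β * V z.2)
        - Real.exp (-β * V z.1 + -(β + δ) * V z.2)| / |δ| ∂(P.prod P)) (increments β)
      (𝓝 (∫ z : E × E, Real.exp (-β * V z.1 + -β * V z.2) * |V z.1 - V z.2| ∂(P.prod P))) := by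
    have : (increments β).IsCountablyGenerated := by unfold increments; infer_instance
    refine tendsto_integral_filter_of_dominated_convergence _ ?_ ?_
      (integrable_abs_sub_mul hV hexp hVexp) ?_
    · exact Eventually.of_forall fun δ =>
        (by fun_prop : Measurable _).aestronglyMeasurable
    · filter_upwards [hmem] with δ hδ
      refine ae_of_all _ fun z => ?_
      rw [Real.norm_eq_abs, abs_div, abs_abs, abs_abs, div_le_iff₀ (abs_pos.2 hδ.1)]
      refine (abs_exp_sub_exp_le _ _).trans ?_
      have e : -(β + δ) * V z.1 + -β * V z.2 - (-β * V z.1 + -(β + δ) * V z.2)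
          = -δ * (V z.1 - V z.2) := by ring
      rw [e, abs_mul, abs_neg]
      have hmax : max (Real.exp (-(β + δ) * V z.1 + -β * V z.2))
          (Real.exp (-β * V z.1 + -(β + δ) * V z.2)) ≤
          (1 + Real.exp (-V z.1)) * (1 + Real.exp (-V z.2)) := by
        rw [Real.exp_add, Real.exp_add]
        exact max_le
          (mul_le_mul (exp_neg_mul_le hδ.2 _) (exp_neg_mul_le hβ _) (Real.exp_pos _).le
            (by positivity))
          (mul_le_mul (exp_neg_mul_le hβ _) (exp_neg_mul_le hδ.2 _) (Real.exp_pos _).le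
            (by positivity))
      refine (mul_le_mul_of_nonneg_left hmax (by positivity)).trans_eq ?_
      ring
    · refine ae_of_all _ fun z => ?_
      have hd : HasDerivAt (fun δ : ℝ => Real.exp (-(β + δ) * V z.1 + -β * V z.2)
          - Real.exp (-β * V z.1 + -(β + δ) * V z.2))
          (Real.exp (-β * V z.1 + -β * V z.2) * (V z.2 - V z.1)) 0 := by
        have h1 : HasDerivAt (fun δ : ℝ => -(β + δ) * V z.1 + -β * V z.2) (-1 * V z.1) 0 :=
          ((((hasDerivAt_id (0 : ℝ)).const_add β).neg).mul_const _).add_const _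
        have h2 : HasDerivAt (fun δ : ℝ => -β * V z.1 + -(β + δ) * V z.2) (-1 * V z.2) 0 :=
          ((((hasDerivAt_id (0 : ℝ)).const_add β).neg).mul_const _).const_add _
        have h3 := h1.exp.sub h2.exp
        simp only [add_zero] at h3
        refine h3.congr_deriv ?_
        ring
      have hs := (hd.tendsto_slope.mono_left
        (nhdsWithin_mono 0 (fun δ (hδ : δ ≠ 0 ∧ β + δ ∈ Icc (0 : ℝ) 1) => hδ.1))).abs
      rw [abs_mul, Real.abs_exp, abs_sub_comm] at hs
      refine Tendsto.congr (fun δ => ?_) hs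
      simp [slope, abs_mul, abs_inv, div_eq_inv_mul]
  have hZpos := integral_exp_neg_mul_pos hVm hexp hβ
  have hlim := hnum.div ((hZcont.const_mul (∫ x, Real.exp (-β * V x) ∂P)).const_mul 2)
    (by positivity)
  rw [tilted_prod_tilted P P (by fun_prop) (by fun_prop), integral_tilted_eq_div]
  have hmass : ∫ z : E × E, Real.exp (-β * V z.1 + -β * V z.2) ∂(P.prod P)
      = (∫ x, Real.exp (-β * V x) ∂P) * ∫ x, Real.exp (-β * V x) ∂P := by
    simp_rw [Real.exp_add]
    exact integral_prod_mul (fun x => Real.exp (-β * V x)) (fun x => Real.exp (-β * V x))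
  rw [hmass, div_div, mul_comm _ (2 : ℝ)]
  refine hlim.congr' ?_
  filter_upwards [hmem] with δ hδ
  rw [one_sub_integral_exp_min hVm hexp hβ hδ.2, Pi.div_apply, integral_div, div_right_comm]

/-- The mean absolute difference of two independent tilted energies is continuous in the inverse
temperature. -/
lemma continuousOn_integral_abs_sub (hVm : Measurable V) (hV : Integrable V P)
    (hexp : Integrable (fun x => Real.exp (-V x)) P)
    (hVexp : Integrable (fun x => Real.exp (-V x) * V x) P) :
    ContinuousOn (fun β : ℝ => ∫ z : E × E, |V z.1 - V z.2|
        ∂((P.tilted fun x => -β * V x).prod (P.tilted fun x => -β * V x))) (Icc 0 1) := by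
  have h : ∀ β : ℝ, (P.tilted fun x => -β * V x).prod (P.tilted fun x => -β * V x)
      = (P.prod P).tilted fun z => -β * (V z.1 + V z.2) := by
    intro β
    rw [tilted_prod_tilted P P (by fun_prop) (by fun_prop)]
    simp_rw [mul_add]
  simp_rw [h]
  have hD := integrable_abs_sub_mul hV hexp hVexp
  refine continuousOn_integral_tilted (U := fun z : E × E => V z.1 + V z.2) (by fun_prop) ?_ ?_ ?_
  · simp_rw [neg_add, Real.exp_add]
    exact hexp.mul_prod hexp
  · exact ((hV.comp_fst P).sub (hV.comp_snd P)).abs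
  · refine hD.mono' (by fun_prop) (ae_of_all _ fun z => ?_)
    simp only [neg_add, Real.exp_add, norm_mul, Real.norm_eq_abs, Real.abs_exp, abs_abs]
    have h1 := Real.exp_pos (-V z.1)
    have h2 := Real.exp_pos (-V z.2)
    rw [mul_comm]
    gcongr <;> linarith

end Swap

/-! ### Convergence of absolute moments in the central limit theorem -/

lemma integral_abs_gaussianReal_zero_one :
    ∫ x, |x| ∂(gaussianReal 0 1) = √(2 / Real.pi) := by
  have h1 : ∫ x in Ioi (0 : ℝ), x * Real.exp (-x ^ 2 / 2) = 1 := by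
    have h := integral_rpow_mul_exp_neg_mul_rpow (b := 1 / 2) (p := 2) (q := 1)
      (by norm_num) (by norm_num) (by norm_num)
    have h2 : ∀ x : ℝ, x ^ (1 : ℝ) * Real.exp (-(1 / 2) * x ^ (2 : ℝ))
        = x * Real.exp (-x ^ 2 / 2) := by
      intro x
      rw [Real.rpow_one, Real.rpow_two]
      ring_nf
    simp_rw [h2] at h
    rw [h]
    norm_num [Real.rpow_neg_one]
  rw [integral_gaussianReal_eq_integral_smul (by norm_num)]
  have h2 : ∀ x : ℝ, gaussianPDFReal 0 1 x • |x|
      = (fun y => (√(2 * Real.pi))⁻¹ * (y * Real.exp (-y ^ 2 / 2))) |x| := by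
    intro x
    simp [gaussianPDFReal]
    ring
  simp_rw [h2]
  rw [integral_comp_abs (f := fun y => (√(2 * Real.pi))⁻¹ * (y * Real.exp (-y ^ 2 / 2))),
    integral_const_mul, h1, mul_one]
  have hpi := Real.pi_pos
  rw [Real.sqrt_div (by norm_num), Real.sqrt_mul (by norm_num)]
  have h3 : √2 * √2 = (2 : ℝ) := Real.mul_self_sqrt (by norm_num)
  field_simp
  nlinarith [h3]

/-- Chebyshev-type control of the tail of the first absolute moment by the second moment. -/
lemma abs_integral_abs_sub_integral_min_le {m : Measure ℝ} [IsProbabilityMeasure m] {C M : ℝ}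
    (hM : 0 < M) (hint : Integrable (fun x : ℝ => x ^ 2) m) (hC : ∫ x, x ^ 2 ∂m ≤ C) :
    |∫ x, |x| ∂m - ∫ x, min |x| M ∂m| ≤ C / M := by
  have h1 : Integrable (fun x : ℝ => |x|) m := by
    refine (hint.add (integrable_const 1)).mono' (by fun_prop) (ae_of_all _ fun x => ?_)
    simp only [Pi.add_apply, Real.norm_eq_abs, abs_abs]
    nlinarith [sq_abs x, sq_nonneg (|x| - 1), abs_nonneg x]
  have h2 : Integrable (fun x : ℝ => min |x| M) m := by
    refine h1.mono' (by fun_prop) (ae_of_all _ fun x => ?_)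
    rw [Real.norm_eq_abs, abs_of_nonneg (le_min (abs_nonneg x) hM.le)]
    exact min_le_left _ _
  rw [← integral_sub h1 h2, abs_of_nonneg
    (integral_nonneg fun x => sub_nonneg.2 (min_le_left _ _))]
  calc ∫ x, (|x| - min |x| M) ∂m ≤ ∫ x, x ^ 2 / M ∂m := by
        refine integral_mono (h1.sub h2) (hint.div_const M) fun x => ?_
        simp only
        rw [le_div_iff₀ hM]
        rcases le_total |x| M with h | h
        · rw [min_eq_left h]
          nlinarith [sq_nonneg x]
        · rw [min_eq_right h]
          nlinarith [sq_abs x, sq_nonneg (|x| - M)]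
    _ = (∫ x, x ^ 2 ∂m) / M := integral_div _ _
    _ ≤ C / M := by gcongr

/-- Weak convergence together with bounded second moments yields convergence of the first
absolute moments. -/
lemma tendsto_integral_abs_of_tendsto {μ : ℕ → ProbabilityMeasure ℝ} {μ₀ : ProbabilityMeasure ℝ}
    (h : Tendsto μ atTop (𝓝 μ₀)) {C : ℝ}
    (hint : ∀ n, Integrable (fun x : ℝ => x ^ 2) (μ n : Measure ℝ))
    (hC : ∀ n, ∫ x, x ^ 2 ∂(μ n : Measure ℝ) ≤ C)
    (hint₀ : Integrable (fun x : ℝ => x ^ 2) (μ₀ : Measure ℝ))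
    (hC₀ : ∫ x, x ^ 2 ∂(μ₀ : Measure ℝ) ≤ C) :
    Tendsto (fun n => ∫ x, |x| ∂(μ n : Measure ℝ)) atTop (𝓝 (∫ x, |x| ∂(μ₀ : Measure ℝ))) := by
  have hC_nonneg : 0 ≤ C := (integral_nonneg fun x => sq_nonneg x).trans hC₀
  rw [Metric.tendsto_atTop]
  intro ε hε
  -- Truncation at `M` changes each moment by at most `C / M < ε / 3`.
  set M : ℝ := 4 * (C + 1) / ε
  have hM : 0 < M := by positivity
  have hCM : C / M < ε / 3 := by
    rw [div_lt_iff₀ hM]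
    have : ε / 3 * M = 4 * (C + 1) / 3 := by simp only [M]; field_simp
    rw [this]; linarith
  let f : BoundedContinuousFunction ℝ ℝ :=
    BoundedContinuousFunction.ofNormedAddCommGroup (fun x => min |x| M) (by fun_prop) M
      (fun x => by
        rw [Real.norm_eq_abs, abs_of_nonneg (le_min (abs_nonneg x) hM.le)]
        exact min_le_right _ _)
  have hf := (ProbabilityMeasure.tendsto_iff_forall_integral_tendsto.1 h) f
  obtain ⟨N, hN⟩ := (Metric.tendsto_atTop.1 hf) (ε / 3) (by positivity)
  refine ⟨N, fun n hn => ?_⟩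
  have h1 := abs_integral_abs_sub_integral_min_le hM (hint n) (hC n)
  have h2 := abs_integral_abs_sub_integral_min_le hM hint₀ hC₀
  have h3 := hN n hn
  simp only [f, BoundedContinuousFunction.coe_ofNormedAddCommGroup, Real.dist_eq] at h3
  rw [Real.dist_eq]
  rw [abs_le] at h1 h2
  rw [abs_lt] at h3 ⊢
  constructor <;> linarith [h1.1, h1.2, h2.1, h2.2, h3.1, h3.2]

section Sums

variable {Ω : Type*} [MeasurableSpace Ω]

lemma memLp_sum_eval (μ : Measure Ω) [IsProbabilityMeasure μ] {W : Ω → ℝ}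
    (hW2 : MemLp W 2 μ) (d : ℕ) :
    MemLp (fun z : Fin d → Ω => ∑ i, W (z i)) 2 (Measure.pi fun _ => μ) :=
  memLp_finsetSum _ fun i _ => hW2.comp_measurePreserving (measurePreserving_eval (fun _ => μ) i)

lemma integral_sum_eval_sq (μ : Measure Ω) [IsProbabilityMeasure μ] {W : Ω → ℝ}
    (hW2 : MemLp W 2 μ) (h0 : ∫ z, W z ∂μ = 0) (d : ℕ) :
    ∫ z : Fin d → Ω, (∑ i, W (z i)) ^ 2 ∂(Measure.pi fun _ => μ) = d * ∫ z, W z ^ 2 ∂μ := by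
  have hvar := variance_sum_pi (ι := Fin d) (μ := fun _ => μ) (X := fun _ => W) (fun _ => hW2)
  have hmean : ∫ z : Fin d → Ω, (∑ i, W (z i)) ∂(Measure.pi fun _ => μ) = 0 := by
    rw [integral_finsetSum]
    · refine Finset.sum_eq_zero fun i _ => ?_
      rw [integral_comp_eval (μ := fun _ => μ) (i := i) hW2.aestronglyMeasurable, h0]
    · intro i _
      exact integrable_comp_eval (μ := fun _ => μ) (hW2.integrable (by norm_num))
  have e : (∑ i, fun ω : Fin d → Ω => W (ω i)) = fun ω => ∑ i, W (ω i) := by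
    ext; simp
  rw [e, variance_of_integral_eq_zero (memLp_sum_eval μ hW2 d).aemeasurable hmean,
    variance_of_integral_eq_zero hW2.aemeasurable h0] at hvar
  rw [hvar]
  simp

/-- The first absolute moment of a sum of `d` independent copies of a centred, square-integrable
variable of unit variance is asymptotic to that of a centred Gaussian of variance `d`. -/
lemma tendsto_integral_abs_sum_of_unit (μ : Measure Ω) [IsProbabilityMeasure μ] {W : Ω → ℝ}
    (hW2 : MemLp W 2 μ) (h0 : ∫ z, W z ∂μ = 0)
    (h1 : ∫ z, W z ^ 2 ∂μ = 1) :
    Tendsto (fun d : ℕ => (√d)⁻¹ * ∫ z : Fin d → Ω, |∑ i, W (z i)| ∂(Measure.pi fun _ => μ))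
      atTop (𝓝 √(2 / Real.pi)) := by
  have hS : ∀ d : ℕ, AEMeasurable (fun z : Fin d → Ω => (√d)⁻¹ * ∑ i, W (z i))
      (Measure.pi fun _ => μ) := fun d =>
    ((memLp_sum_eval μ hW2 d).aemeasurable).const_mul _
  let m : ℕ → ProbabilityMeasure ℝ := fun d =>
    ⟨(Measure.pi fun _ => μ).map (fun z : Fin d → Ω => (√d)⁻¹ * ∑ i, W (z i)),
      Measure.isProbabilityMeasure_map (hS d)⟩
  have hm : ∀ d, (m d : Measure ℝ) =
    (Measure.pi fun _ => μ).map (fun z : Fin d → Ω => (√d)⁻¹ * ∑ i, W (z i)) := fun d => rfl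
  let g : ProbabilityMeasure ℝ := ⟨gaussianReal 0 1, inferInstance⟩
  have hg : (g : Measure ℝ) = gaussianReal 0 1 := rfl
  -- Lévy's continuity theorem applies to laws on varying spaces, so that the sums need not be
  -- realised on one common probability space.
  have hlim : Tendsto m atTop (𝓝 g) := by
    refine ProbabilityMeasure.tendsto_iff_tendsto_charFun.2 fun t => ?_
    have hchar : ∀ d, charFun (m d : Measure ℝ) t = (charFun (μ.map W) ((√d)⁻¹ * t)) ^ d := by
      intro d
      have hind := iIndepFun_pi (ι := Fin d) (μ := fun _ => μ) (X := fun _ => W)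
        (fun _ => hW2.aemeasurable)
      have hmeas : ∀ i : Fin d, AEMeasurable (fun z : Fin d → Ω => W (z i))
          (Measure.pi fun _ => μ) := fun i =>
        (hW2.comp_measurePreserving (measurePreserving_eval (fun _ => μ) i)).aemeasurable
      rw [hm, charFun_map_mul_comp (memLp_sum_eval μ hW2 d).aemeasurable,
        hind.charFun_map_fun_sum_eq_prod hmeas]
      have hmap : ∀ i : Fin d, (Measure.pi fun _ => μ).map (fun z : Fin d → Ω => W (z i))
          = μ.map W := by
        intro i
        have hp := measurePreserving_eval (fun _ : Fin d => μ) i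
        have := AEMeasurable.map_map_of_aemeasurable (μ := Measure.pi fun _ : Fin d => μ)
          (g := W) (f := Function.eval i) (by rw [hp.map_eq]; exact hW2.aemeasurable)
          hp.measurable.aemeasurable
        rw [hp.map_eq] at this
        rw [this]; rfl
      simp [hmap]
    simp_rw [hchar, hg, charFun_gaussianReal]
    simpa [neg_div] using tendsto_charFun_inv_sqrt_mul_pow hW2.aemeasurable h0 h1 t
  have hsq : ∀ d, Integrable (fun x : ℝ => x ^ 2) (m d : Measure ℝ) := by
    intro d
    rw [hm, integrable_map_measure (by fun_prop) (hS d)]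
    exact ((memLp_sum_eval μ hW2 d).const_mul _).integrable_sq
  have hsq_le : ∀ d, ∫ x, x ^ 2 ∂(m d : Measure ℝ) ≤ 1 := by
    intro d
    rw [hm, integral_map (hS d) (by fun_prop)]
    simp_rw [mul_pow]
    rw [integral_const_mul, integral_sum_eval_sq μ hW2 h0, h1, mul_one, inv_pow,
      Real.sq_sqrt (Nat.cast_nonneg d)]
    exact inv_mul_le_one
  have hvar : ∫ x, x ^ 2 ∂(gaussianReal 0 1) = 1 := by
    have := variance_fun_id_gaussianReal (μ := 0) (v := 1)
    rw [variance_of_integral_eq_zero (by fun_prop) (by simp)] at this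
    simpa using this
  have key := tendsto_integral_abs_of_tendsto hlim hsq hsq_le
    (by rw [hg]; exact (memLp_id_gaussianReal 2).integrable_sq) (by rw [hg, hvar])
  rw [hg, integral_abs_gaussianReal_zero_one] at key
  refine key.congr fun d => ?_
  rw [hm, integral_map (hS d) (by fun_prop), ← integral_const_mul]
  simp_rw [abs_mul, abs_of_nonneg (inv_nonneg.2 (Real.sqrt_nonneg (d : ℝ)))]

/-- Jensen's inequality for the sum of `d` independent copies of a centred variable. -/
lemma integral_abs_sum_le (μ : Measure Ω) [IsProbabilityMeasure μ] {W : Ω → ℝ}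
    (hW2 : MemLp W 2 μ) (h0 : ∫ z, W z ∂μ = 0) (d : ℕ) :
    ∫ z : Fin d → Ω, |∑ i, W (z i)| ∂(Measure.pi fun _ => μ) ≤ √(d * ∫ z, W z ^ 2 ∂μ) := by
  have hL := memLp_sum_eval μ hW2 d
  rw [← integral_sum_eval_sq μ hW2 h0]
  refine Real.le_sqrt_of_sq_le ?_
  have h := variance_nonneg (fun z : Fin d → Ω => |∑ i, W (z i)|) (Measure.pi fun _ => μ)
  rw [variance_eq_sub (show MemLp (fun z : Fin d → Ω => |∑ i, W (z i)|) 2 _ from hL.abs)] at h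
  simpa [sq_abs] using h

/-- The first absolute moment of a sum of `d` independent copies of a centred variable of
variance `v` is asymptotic to `√(2 v d / π)`. -/
lemma tendsto_integral_abs_sum (μ : Measure Ω) [IsProbabilityMeasure μ] {W : Ω → ℝ}
    (hW2 : MemLp W 2 μ) (h0 : ∫ z, W z ∂μ = 0) :
    Tendsto (fun d : ℕ => (√d)⁻¹ * ∫ z : Fin d → Ω, |∑ i, W (z i)| ∂(Measure.pi fun _ => μ))
      atTop (𝓝 (√(∫ z, W z ^ 2 ∂μ) * √(2 / Real.pi))) := by
  set v := ∫ z, W z ^ 2 ∂μ with hv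
  have hv0 : 0 ≤ v := integral_nonneg fun z => sq_nonneg _
  rcases hv0.eq_or_lt with h | h
  · have hz : ∀ d : ℕ, ∫ z : Fin d → Ω, |∑ i, W (z i)| ∂(Measure.pi fun _ => μ) = 0 := by
      intro d
      refine le_antisymm ?_ (integral_nonneg fun z => abs_nonneg _)
      have := integral_abs_sum_le μ hW2 h0 d
      rwa [← hv, ← h, mul_zero, Real.sqrt_zero] at this
    simp_rw [hz, ← h]
    simp
  · have hs : 0 < √v := Real.sqrt_pos.2 h
    have key := tendsto_integral_abs_sum_of_unit μ (W := fun z => (√v)⁻¹ * W z)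
      (hW2.const_mul _) (by rw [integral_const_mul, h0, mul_zero])
      (by simp_rw [mul_pow]
          rw [integral_const_mul, ← hv, inv_pow, Real.sq_sqrt hv0, inv_mul_cancel₀ h.ne'])
    refine (key.const_mul √v).congr fun d => ?_
    simp_rw [← Finset.mul_sum, abs_mul, abs_of_pos (inv_pos.2 hs)]
    rw [integral_const_mul]
    field_simp

end Sums

/-! ### Annealed distributions as exponential tilts -/

/-- A reference density `p₀` and a target density `p`, both positive, normalised and measurable,
for which the energy has a finite first moment under reference and target. -/
structure IsIntegrablePair {X : Type*} [MeasurableSpace X] (ν : Measure X) (p₀ p : X → ℝ) :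
    Prop where
  measurable_reference : Measurable p₀
  measurable_target : Measurable p
  reference_pos : ∀ x, 0 < p₀ x
  target_pos : ∀ x, 0 < p x
  isProbabilityMeasure_reference : IsProbabilityMeasure (densityMeasure ν p₀)
  isProbabilityMeasure_target : IsProbabilityMeasure (densityMeasure ν p)
  integrable_energy_reference : Integrable (energy p₀ p) (densityMeasure ν p₀)
  integrable_energy_target : Integrable (energy p₀ p) (densityMeasure ν p)

/-- At every `β ∈ [0, 1]` there are admissible increments of arbitrarily small size, on at least one
side. -/
lemma increments_neBot {β : ℝ} (hβ : β ∈ Icc (0 : ℝ) 1) : (increments β).NeBot := by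
  unfold increments
  rw [← mem_closure_iff_nhdsWithin_neBot, Metric.mem_closure_iff]
  intro ε hε
  rcases le_total β (1 / 2) with h | h
  · refine ⟨min (ε / 2) (1 / 2), ⟨by positivity, ?_, ?_⟩, ?_⟩
    · have : 0 ≤ min (ε / 2) (1 / 2) := by positivity
      linarith [hβ.1]
    · linarith [min_le_right (ε / 2) (1 / 2)]
    · rw [Real.dist_eq, zero_sub, abs_neg, abs_of_pos (by positivity)]
      linarith [min_le_left (ε / 2) (1 / 2)]
  · refine ⟨-min (ε / 2) (1 / 2), ⟨neg_ne_zero.2 (by positivity), ?_, ?_⟩, ?_⟩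
    · linarith [min_le_right (ε / 2) (1 / 2)]
    · have : 0 ≤ min (ε / 2) (1 / 2) := by positivity
      linarith [hβ.2]
    · rw [Real.dist_eq, zero_sub, neg_neg, abs_of_pos (by positivity)]
      linarith [min_le_left (ε / 2) (1 / 2)]

lemma likelihood_prodDensity {X : Type*} (p₀ p : X → ℝ) (d : ℕ) (x : Fin d → X) :
    likelihood (prodDensity p₀ d) (prodDensity p d) x = ∏ i, likelihood p₀ p (x i) := by
  simp [likelihood, prodDensity, Finset.prod_div_distrib]

lemma energy_prodDensity {X : Type*} {p₀ p : X → ℝ} (hp₀_pos : ∀ x, 0 < p₀ x)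
    (hp_pos : ∀ x, 0 < p x) (d : ℕ) (x : Fin d → X) :
    energy (prodDensity p₀ d) (prodDensity p d) x = ∑ i, energy p₀ p (x i) := by
  simp only [energy, likelihood_prodDensity]
  have hL : ∀ y, likelihood p₀ p y ≠ 0 := fun y => (div_pos (hp_pos y) (hp₀_pos y)).ne'
  rw [Real.log_prod fun i _ => hL _, Finset.sum_neg_distrib]

lemma exp_neg_mul_energy {X : Type*} {p₀ p : X → ℝ} (hp₀_pos : ∀ x, 0 < p₀ x)
    (hp_pos : ∀ x, 0 < p x) (β : ℝ) (x : X) :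
    Real.exp (-β * energy p₀ p x) = likelihood p₀ p x ^ β := by
  have hL : 0 < likelihood p₀ p x := div_pos (hp_pos x) (hp₀_pos x)
  rw [Real.rpow_def_of_pos hL, energy]
  ring_nf

section

variable {X : Type*} [MeasurableSpace X] {ν : Measure X} {p₀ p : X → ℝ}

lemma measurable_energy (hp₀ : Measurable p₀) (hp : Measurable p) : Measurable (energy p₀ p) :=
  (hp.div hp₀).log.neg

lemma integral_densityMeasure (hp₀ : Measurable p₀) (hp₀_pos : ∀ x, 0 < p₀ x) (g : X → ℝ) :
    ∫ x, g x ∂(densityMeasure ν p₀) = ∫ x, g x * p₀ x ∂ν := by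
  rw [densityMeasure, integral_withDensity_eq_integral_toReal_smul (by fun_prop) (by simp)]
  refine integral_congr_ae (ae_of_all _ fun x => ?_)
  simp only [smul_eq_mul]
  rw [ENNReal.toReal_ofReal (hp₀_pos x).le, mul_comm]

lemma integrable_densityMeasure_iff (hp₀ : Measurable p₀) (hp₀_pos : ∀ x, 0 < p₀ x) {g : X → ℝ} :
    Integrable g (densityMeasure ν p₀) ↔ Integrable (fun x => g x * p₀ x) ν := by
  rw [densityMeasure, integrable_withDensity_iff_integrable_smul' (by fun_prop) (by simp)]
  refine integrable_congr (ae_of_all _ fun x => ?_)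
  simp only [smul_eq_mul]
  rw [ENNReal.toReal_ofReal (hp₀_pos x).le, mul_comm]

lemma annealed_eq_tilted (hp₀ : Measurable p₀) (hp : Measurable p) (hp₀_pos : ∀ x, 0 < p₀ x)
    (hp_pos : ∀ x, 0 < p x) (β : ℝ) :
    annealed ν p₀ p β = (densityMeasure ν p₀).tilted (fun x => -β * energy p₀ p x) := by
  have hE := measurable_energy hp₀ hp
  have hZ : normalizer ν p₀ p β = ∫ x, Real.exp (-β * energy p₀ p x) ∂(densityMeasure ν p₀) := by
    rw [integral_densityMeasure hp₀ hp₀_pos, normalizer]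
    simp_rw [exp_neg_mul_energy hp₀_pos hp_pos]
  rw [annealed, Measure.tilted, ← hZ]
  simp_rw [exp_neg_mul_energy hp₀_pos hp_pos]
  unfold densityMeasure
  rw [← withDensity_mul _ (by fun_prop)
    (by simp_rw [← exp_neg_mul_energy hp₀_pos hp_pos]; fun_prop)]
  congr 1
  ext x
  rw [Pi.mul_apply, ← ENNReal.ofReal_mul (hp₀_pos x).le]
  ring_nf

lemma densityMeasure_target_eq_withDensity (hp₀ : Measurable p₀) (hp : Measurable p)
    (hp₀_pos : ∀ x, 0 < p₀ x) (hp_pos : ∀ x, 0 < p x) :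
    densityMeasure ν p =
      (densityMeasure ν p₀).withDensity (fun x => ENNReal.ofReal (Real.exp (-energy p₀ p x))) := by
  have hE := measurable_energy hp₀ hp
  unfold densityMeasure
  rw [← withDensity_mul _ (by fun_prop) (by fun_prop)]
  congr 1
  ext x
  have := exp_neg_mul_energy hp₀_pos hp_pos 1 x
  rw [neg_one_mul, Real.rpow_one] at this
  rw [Pi.mul_apply, ← ENNReal.ofReal_mul (hp₀_pos x).le, this, likelihood,
    mul_div_cancel₀ _ (hp₀_pos x).ne']

lemma integrable_target_iff (hp₀ : Measurable p₀) (hp : Measurable p)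
    (hp₀_pos : ∀ x, 0 < p₀ x) (hp_pos : ∀ x, 0 < p x) {g : X → ℝ} :
    Integrable g (densityMeasure ν p) ↔
      Integrable (fun x => Real.exp (-energy p₀ p x) * g x) (densityMeasure ν p₀) := by
  have hE := measurable_energy hp₀ hp
  rw [densityMeasure_target_eq_withDensity hp₀ hp hp₀_pos hp_pos,
    integrable_withDensity_iff_integrable_smul' (by fun_prop) (by simp)]
  refine integrable_congr (ae_of_all _ fun x => ?_)
  simp only [smul_eq_mul]
  rw [ENNReal.toReal_ofReal (Real.exp_pos _).le]

namespace IsIntegrablePair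

variable (h : IsIntegrablePair ν p₀ p)
include h

lemma measurable_energy : Measurable (energy p₀ p) :=
  Tempering.measurable_energy h.measurable_reference h.measurable_target

lemma integrable_exp_neg_energy :
    Integrable (fun x => Real.exp (-energy p₀ p x)) (densityMeasure ν p₀) := by
  have := h.isProbabilityMeasure_target
  simpa using (integrable_target_iff h.measurable_reference h.measurable_target h.reference_pos
    h.target_pos).1 (integrable_const (μ := densityMeasure ν p) (1 : ℝ))

lemma integrable_exp_neg_energy_mul {g : X → ℝ} (hg : Integrable g (densityMeasure ν p)) :
    Integrable (fun x => Real.exp (-energy p₀ p x) * g x) (densityMeasure ν p₀) :=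
  (integrable_target_iff h.measurable_reference h.measurable_target h.reference_pos
    h.target_pos).1 hg

lemma annealed_eq (β : ℝ) :
    annealed ν p₀ p β = (densityMeasure ν p₀).tilted (fun x => -β * energy p₀ p x) :=
  annealed_eq_tilted h.measurable_reference h.measurable_target h.reference_pos h.target_pos β

lemma integrable_exp_neg_mul_energy {β : ℝ} (hβ : β ∈ Icc (0 : ℝ) 1) :
    Integrable (fun x => Real.exp (-β * energy p₀ p x)) (densityMeasure ν p₀) :=
  have := h.isProbabilityMeasure_reference
  integrable_exp_neg_mul h.measurable_energy h.integrable_exp_neg_energy hβ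

lemma isProbabilityMeasure_annealed {β : ℝ} (hβ : β ∈ Icc (0 : ℝ) 1) :
    IsProbabilityMeasure (annealed ν p₀ p β) := by
  have := h.isProbabilityMeasure_reference
  rw [h.annealed_eq]
  exact isProbabilityMeasure_tilted (h.integrable_exp_neg_mul_energy hβ)

lemma integrable_annealed {g : X → ℝ} (hg₀ : Integrable g (densityMeasure ν p₀))
    (hg : Integrable g (densityMeasure ν p)) {β : ℝ} (hβ : β ∈ Icc (0 : ℝ) 1) :
    Integrable g (annealed ν p₀ p β) := by
  rw [h.annealed_eq, integrable_tilted_iff (h.integrable_exp_neg_mul_energy hβ)]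
  exact integrable_exp_neg_mul_mul h.measurable_energy hg₀ (h.integrable_exp_neg_energy_mul hg) hβ

lemma continuousOn_integral_annealed {g : X → ℝ} (hg₀ : Integrable g (densityMeasure ν p₀))
    (hg : Integrable g (densityMeasure ν p)) :
    ContinuousOn (fun β : ℝ => ∫ x, g x ∂(annealed ν p₀ p β)) (Icc 0 1) := by
  have := h.isProbabilityMeasure_reference
  simp_rw [h.annealed_eq]
  exact continuousOn_integral_tilted h.measurable_energy h.integrable_exp_neg_energy hg₀
    (h.integrable_exp_neg_energy_mul hg)

/-- The local communication barrier exists and is half the mean absolute difference of two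
independent energies at the given inverse temperature. -/
lemma tendsto_rejectionProb_div {β : ℝ} (hβ : β ∈ Icc (0 : ℝ) 1) :
    Tendsto (fun δ : ℝ => rejectionProb ν p₀ p β (β + δ) / |δ|) (increments β)
      (𝓝 ((∫ z : X × X, |energy p₀ p z.1 - energy p₀ p z.2|
        ∂((annealed ν p₀ p β).prod (annealed ν p₀ p β))) / 2)) := by
  have := h.isProbabilityMeasure_reference
  unfold rejectionProb swapProb
  simp_rw [h.annealed_eq]
  exact tendsto_rejection_div h.measurable_energy h.integrable_energy_reference
    h.integrable_exp_neg_energy (h.integrable_exp_neg_energy_mul h.integrable_energy_target) hβ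

/-- The value of `localBarrier`, a `limUnder`, at parameters where the limit exists. -/
lemma localBarrier_eq {β : ℝ} (hβ : β ∈ Icc (0 : ℝ) 1) :
    localBarrier ν p₀ p β = (∫ z : X × X, |energy p₀ p z.1 - energy p₀ p z.2|
        ∂((annealed ν p₀ p β).prod (annealed ν p₀ p β))) / 2 :=
  have := increments_neBot hβ
  (h.tendsto_rejectionProb_div hβ).limUnder_eq

lemma continuousOn_localBarrier : ContinuousOn (localBarrier ν p₀ p) (Icc 0 1) := by
  have := h.isProbabilityMeasure_reference
  refine ContinuousOn.congr (f := fun β : ℝ => (∫ z : X × X, |energy p₀ p z.1 - energy p₀ p z.2|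
        ∂((annealed ν p₀ p β).prod (annealed ν p₀ p β))) / 2) ?_ fun β hβ => h.localBarrier_eq hβ
  simp_rw [h.annealed_eq]
  exact (continuousOn_integral_abs_sub h.measurable_energy h.integrable_energy_reference
    h.integrable_exp_neg_energy
    (h.integrable_exp_neg_energy_mul h.integrable_energy_target)).div_const 2

lemma integrable_reference : Integrable p₀ ν := by
  have := h.isProbabilityMeasure_reference
  simpa using (integrable_densityMeasure_iff h.measurable_reference h.reference_pos).1
    (integrable_const (μ := densityMeasure ν p₀) (1 : ℝ))

lemma integrable_target : Integrable p ν := by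
  have := h.isProbabilityMeasure_target
  simpa using (integrable_densityMeasure_iff h.measurable_target h.target_pos).1
    (integrable_const (μ := densityMeasure ν p) (1 : ℝ))

end IsIntegrablePair

/-! ### Product targets -/

/-- Products of nonnegative integrable densities have product distributions, since the integral of
a product density over a box factorises. -/
lemma densityMeasure_prod_eq_pi [SigmaFinite ν] {q : X → ℝ} (hq : Integrable q ν)
    (hq_nonneg : ∀ x, 0 ≤ q x) (d : ℕ) :
    densityMeasure (prodBase ν d) (prodDensity q d) =
      Measure.pi (fun _ : Fin d => densityMeasure ν q) := by
  have : SigmaFinite (densityMeasure ν q) := by unfold densityMeasure; infer_instance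
  symm
  refine Measure.pi_eq fun s hs => ?_
  unfold densityMeasure prodBase prodDensity
  rw [withDensity_apply _ (MeasurableSet.univ_pi hs), Measure.restrict_pi_pi,
    ← ofReal_integral_eq_lintegral_ofReal
      (Integrable.fintype_prod (f := fun _ => q) fun i => hq.restrict)
      (ae_of_all _ fun x => Finset.prod_nonneg fun i _ => hq_nonneg _),
    integral_fintype_prod_eq_prod (fun _ => q),
    ENNReal.ofReal_prod_of_nonneg fun i _ => integral_nonneg fun x => hq_nonneg x]
  refine Finset.prod_congr rfl fun i _ => ?_
  rw [withDensity_apply _ (hs i), ofReal_integral_eq_lintegral_ofReal hq.restrict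
    (ae_of_all _ hq_nonneg)]

namespace IsIntegrablePair

variable [SigmaFinite ν] (h : IsIntegrablePair ν p₀ p)
include h

lemma densityMeasure_prod_reference (d : ℕ) :
    densityMeasure (prodBase ν d) (prodDensity p₀ d) =
      Measure.pi (fun _ : Fin d => densityMeasure ν p₀) :=
  densityMeasure_prod_eq_pi h.integrable_reference (fun x => (h.reference_pos x).le) d

lemma densityMeasure_prod_target (d : ℕ) :
    densityMeasure (prodBase ν d) (prodDensity p d) =
      Measure.pi (fun _ : Fin d => densityMeasure ν p) :=
  densityMeasure_prod_eq_pi h.integrable_target (fun x => (h.target_pos x).le) d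

lemma prod (d : ℕ) :
    IsIntegrablePair (prodBase ν d) (prodDensity p₀ d) (prodDensity p d) := by
  have h₀ := h.isProbabilityMeasure_reference
  have h₁ := h.isProbabilityMeasure_target
  have hE : energy (prodDensity p₀ d) (prodDensity p d) = fun x => ∑ i, energy p₀ p (x i) :=
    funext fun x => energy_prodDensity h.reference_pos h.target_pos d x
  refine ⟨?_, ?_, fun x => Finset.prod_pos fun i _ => h.reference_pos _,
    fun x => Finset.prod_pos fun i _ => h.target_pos _, ?_, ?_, ?_, ?_⟩
  · exact Finset.measurable_fun_prod _ fun i _ =>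
      h.measurable_reference.comp (measurable_pi_apply i)
  · exact Finset.measurable_fun_prod _ fun i _ =>
      h.measurable_target.comp (measurable_pi_apply i)
  · rw [h.densityMeasure_prod_reference]; infer_instance
  · rw [h.densityMeasure_prod_target]; infer_instance
  · rw [h.densityMeasure_prod_reference, hE]
    exact integrable_finsetSum _ fun i _ =>
      integrable_comp_eval (μ := fun _ => densityMeasure ν p₀) h.integrable_energy_reference
  · rw [h.densityMeasure_prod_target, hE]
    exact integrable_finsetSum _ fun i _ =>
      integrable_comp_eval (μ := fun _ => densityMeasure ν p) h.integrable_energy_target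

/-- Annealing commutes with taking products. -/
lemma annealed_prod (d : ℕ) {β : ℝ} (hβ : β ∈ Icc (0 : ℝ) 1) :
    annealed (prodBase ν d) (prodDensity p₀ d) (prodDensity p d) β =
      Measure.pi (fun _ : Fin d => annealed ν p₀ p β) := by
  have hL : ∀ x, 0 ≤ likelihood p₀ p x := fun x =>
    (div_pos (h.target_pos x) (h.reference_pos x)).le
  have hnn : ∀ x, 0 ≤ likelihood p₀ p x ^ β * p₀ x := fun x =>
    mul_nonneg (Real.rpow_nonneg (hL x) _) (h.reference_pos x).le
  have hint : Integrable (fun x => likelihood p₀ p x ^ β * p₀ x / normalizer ν p₀ p β) ν := by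
    have := (integrable_densityMeasure_iff h.measurable_reference h.reference_pos).1
      (h.integrable_exp_neg_mul_energy hβ)
    simp_rw [exp_neg_mul_energy h.reference_pos h.target_pos] at this
    exact this.div_const _
  have hprod : ∀ x : Fin d → X,
      likelihood (prodDensity p₀ d) (prodDensity p d) x ^ β * prodDensity p₀ d x
        = ∏ i, (likelihood p₀ p (x i) ^ β * p₀ (x i)) := by
    intro x
    rw [likelihood_prodDensity, ← Real.finsetProd_rpow _ _ fun i _ => hL _, prodDensity,
      Finset.prod_mul_distrib]
  have hZ : normalizer (prodBase ν d) (prodDensity p₀ d) (prodDensity p d) β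
      = ∏ _i : Fin d, normalizer ν p₀ p β := by
    simp_rw [normalizer, hprod, prodBase]
    exact integral_fintype_prod_eq_prod (fun _ x => likelihood p₀ p x ^ β * p₀ x)
  have := densityMeasure_prod_eq_pi hint
    (fun x => div_nonneg (hnn x) (integral_nonneg fun x => hnn x)) d
  unfold annealed
  rw [← this]
  congr 1
  ext x
  rw [hprod, hZ, prodDensity, Finset.prod_div_distrib]

/-- The local barrier on `X^d` is half the mean absolute value of a sum of `d` independent copies
of the difference of two independent one-coordinate energies. -/
lemma localBarrierDim_eq (d : ℕ) {β : ℝ} (hβ : β ∈ Icc (0 : ℝ) 1) :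
    localBarrierDim ν p₀ p d β =
      (∫ z : Fin d → X × X, |∑ i, (energy p₀ p (z i).1 - energy p₀ p (z i).2)|
        ∂(Measure.pi fun _ => (annealed ν p₀ p β).prod (annealed ν p₀ p β))) / 2 := by
  have := h.isProbabilityMeasure_annealed hβ
  rw [localBarrierDim, (h.prod d).localBarrier_eq hβ, h.annealed_prod d hβ,
    ← (measurePreserving_arrowProdEquivProdArrow X X (Fin d) (fun _ => annealed ν p₀ p β)
      (fun _ => annealed ν p₀ p β)).integral_comp']
  simp_rw [energy_prodDensity h.reference_pos h.target_pos, ← Finset.sum_sub_distrib]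
  rfl

end IsIntegrablePair

end

/-! ### The energy of one coordinate -/

section Difference

variable {E : Type*} [MeasurableSpace E] {μ : Measure E} [IsProbabilityMeasure μ] {f : E → ℝ}

lemma memLp_sub_prod (hf : MemLp f 2 μ) :
    MemLp (fun z : E × E => f z.1 - f z.2) 2 (μ.prod μ) :=
  (hf.comp_fst μ).sub (hf.comp_snd μ)

lemma integral_sub_prod (hf : Integrable f μ) : ∫ z : E × E, (f z.1 - f z.2) ∂(μ.prod μ) = 0 := by
  rw [integral_sub (hf.comp_fst μ) (hf.comp_snd μ), integral_fun_fst f, integral_fun_snd f]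
  simp

lemma integral_sub_sq_prod (hf : MemLp f 2 μ) :
    ∫ z : E × E, (f z.1 - f z.2) ^ 2 ∂(μ.prod μ) = 2 * variance f μ := by
  have hsq := hf.integrable_sq
  have hi := hf.integrable (by norm_num)
  have e : ∀ z : E × E, (f z.1 - f z.2) ^ 2 = f z.1 ^ 2 + f z.2 ^ 2 - 2 * (f z.1 * f z.2) := by
    intro z; ring
  have h1 := hsq.comp_fst μ
  have h2 := hsq.comp_snd μ
  have hsplit := integral_sub (h1.add h2) ((hi.mul_prod hi).const_mul 2)
  simp only [Pi.add_apply] at hsplit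
  simp_rw [e]
  rw [hsplit, integral_add h1 h2,
    integral_const_mul, integral_prod_mul f f, integral_fun_fst (fun x => f x ^ 2),
    integral_fun_snd (fun x => f x ^ 2), variance_eq_sub hf]
  simp only [probReal_univ, one_smul, Pi.pow_apply]
  ring

end Difference

lemma memLp_two_of_integrable_pow_three {E : Type*} [MeasurableSpace E] {μ : Measure E}
    [IsProbabilityMeasure μ] {f : E → ℝ} (hf : Measurable f)
    (h : Integrable (fun x => f x ^ 3) μ) : MemLp f 2 μ := by
  rw [memLp_two_iff_integrable_sq hf.aestronglyMeasurable]
  refine ((integrable_const 1).add h.abs).mono' (by fun_prop) (ae_of_all _ fun x => ?_)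
  simp only [Pi.add_apply, abs_pow, norm_pow, Real.norm_eq_abs]
  rcases le_total |f x| 1 with hx | hx
  · nlinarith [abs_nonneg (f x), pow_nonneg (abs_nonneg (f x)) 3]
  · nlinarith [pow_le_pow_right₀ hx (show 2 ≤ 3 by norm_num)]

namespace IsIntegrablePair

variable {X : Type*} [MeasurableSpace X] {ν : Measure X} {p₀ p : X → ℝ}

lemma memLp_annealed (h : IsIntegrablePair ν p₀ p)
    (h₀ : MemLp (energy p₀ p) 2 (densityMeasure ν p₀))
    (h₁ : MemLp (energy p₀ p) 2 (densityMeasure ν p)) {β : ℝ} (hβ : β ∈ Icc (0 : ℝ) 1) :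
    MemLp (energy p₀ p) 2 (annealed ν p₀ p β) := by
  rw [memLp_two_iff_integrable_sq h.measurable_energy.aestronglyMeasurable]
  exact h.integrable_annealed h₀.integrable_sq h₁.integrable_sq hβ

lemma continuousOn_energyStd (h : IsIntegrablePair ν p₀ p)
    (h₀ : MemLp (energy p₀ p) 2 (densityMeasure ν p₀))
    (h₁ : MemLp (energy p₀ p) 2 (densityMeasure ν p)) :
    ContinuousOn (energyStd ν p₀ p) (Icc 0 1) := by
  refine ContinuousOn.sqrt (ContinuousOn.congr (f := fun β : ℝ =>
    ∫ x, energy p₀ p x ^ 2 ∂(annealed ν p₀ p β) - (∫ x, energy p₀ p x ∂(annealed ν p₀ p β)) ^ 2)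
    ?_ fun β hβ => ?_)
  · exact (h.continuousOn_integral_annealed h₀.integrable_sq h₁.integrable_sq).sub
      ((h.continuousOn_integral_annealed h.integrable_energy_reference
        h.integrable_energy_target).pow 2)
  · have := h.isProbabilityMeasure_annealed hβ
    rw [variance_eq_sub (h.memLp_annealed h₀ h₁ hβ)]
    rfl

/-- If the energy is almost surely constant at some inverse temperature, it is so under the
reference, and normalisation forces the constant to be zero. -/
lemma energyStd_pos (h : IsIntegrablePair ν p₀ p)
    (h₀ : MemLp (energy p₀ p) 2 (densityMeasure ν p₀))
    (h₁ : MemLp (energy p₀ p) 2 (densityMeasure ν p))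
    (hne : densityMeasure ν p₀ ≠ densityMeasure ν p) {β : ℝ} (hβ : β ∈ Icc (0 : ℝ) 1) :
    0 < energyStd ν p₀ p β := by
  have hP₀ := h.isProbabilityMeasure_reference
  have hP₁ := h.isProbabilityMeasure_target
  have hPβ := h.isProbabilityMeasure_annealed hβ
  refine Real.sqrt_pos.2 ((variance_nonneg _ _).lt_of_ne fun hvar => hne ?_)
  have hconst := ae_eq_integral_of_variance_eq_zero (h.memLp_annealed h₀ h₁ hβ) hvar.symm
  set c := ∫ x, energy p₀ p x ∂(annealed ν p₀ p β)
  have hac : densityMeasure ν p₀ ≪ annealed ν p₀ p β := by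
    rw [h.annealed_eq]
    exact absolutelyContinuous_tilted (h.integrable_exp_neg_mul_energy hβ)
  have hae : ∀ᵐ x ∂(densityMeasure ν p₀), energy p₀ p x = c := hac.ae_le hconst
  have hdens := densityMeasure_target_eq_withDensity (ν := ν) h.measurable_reference
    h.measurable_target h.reference_pos h.target_pos
  have hscale : densityMeasure ν p
      = ENNReal.ofReal (Real.exp (-c)) • densityMeasure ν p₀ := by
    rw [hdens, withDensity_congr_ae (g := fun _ => ENNReal.ofReal (Real.exp (-c)))
      (hae.mono fun x hx => by simp only [hx]), withDensity_const]
  have hone : ENNReal.ofReal (Real.exp (-c)) = 1 := by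
    have := congrArg (fun m : Measure X => m univ) hscale
    simpa using this.symm
  rw [hscale, hone, one_smul]

/-! ### Growth of the barriers with the dimension -/

variable [SigmaFinite ν]

lemma localBarrierDim_nonneg (h : IsIntegrablePair ν p₀ p) (d : ℕ) {β : ℝ}
    (hβ : β ∈ Icc (0 : ℝ) 1) : 0 ≤ localBarrierDim ν p₀ p d β := by
  rw [h.localBarrierDim_eq d hβ]
  exact div_nonneg (integral_nonneg fun z => abs_nonneg _) zero_le_two

/-- The bound, uniform in `d` after division by `√d`, that dominates the passage to the limit in the
global barrier. It also shows that the barriers vanish identically where `σ` does. -/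
lemma localBarrierDim_le (h : IsIntegrablePair ν p₀ p)
    (h₀ : MemLp (energy p₀ p) 2 (densityMeasure ν p₀))
    (h₁ : MemLp (energy p₀ p) 2 (densityMeasure ν p)) (d : ℕ) {β : ℝ}
    (hβ : β ∈ Icc (0 : ℝ) 1) :
    localBarrierDim ν p₀ p d β ≤ √d * energyStd ν p₀ p β := by
  have hPβ := h.isProbabilityMeasure_annealed hβ
  have hL := h.memLp_annealed h₀ h₁ hβ
  have hle := integral_abs_sum_le _ (memLp_sub_prod hL)
    (integral_sub_prod (hL.integrable (by norm_num))) d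
  rw [integral_sub_sq_prod hL] at hle
  rw [h.localBarrierDim_eq d hβ]
  have hs : √(d * (2 * variance (energy p₀ p) (annealed ν p₀ p β)))
      = √2 * (√d * energyStd ν p₀ p β) := by
    rw [energyStd, ← Real.sqrt_mul (Nat.cast_nonneg d), ← Real.sqrt_mul zero_le_two]
    ring_nf
  -- The sharp bound carries the factor `√2 / 2`; any integrable multiple of `σ` suffices here.
  have h2 : √2 ≤ (2 : ℝ) := Real.sqrt_le_iff.2 ⟨by norm_num, by norm_num⟩
  have hnn : 0 ≤ √d * energyStd ν p₀ p β := mul_nonneg (Real.sqrt_nonneg _) (Real.sqrt_nonneg _)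
  rw [hs] at hle
  linarith [mul_le_mul_of_nonneg_right h2 hnn]

lemma tendsto_inv_sqrt_mul_localBarrierDim (h : IsIntegrablePair ν p₀ p)
    (h₀ : MemLp (energy p₀ p) 2 (densityMeasure ν p₀))
    (h₁ : MemLp (energy p₀ p) 2 (densityMeasure ν p)) {β : ℝ} (hβ : β ∈ Icc (0 : ℝ) 1) :
    Tendsto (fun d : ℕ => (√d)⁻¹ * localBarrierDim ν p₀ p d β) atTop
      (𝓝 ((√Real.pi)⁻¹ * energyStd ν p₀ p β)) := by
  have hPβ := h.isProbabilityMeasure_annealed hβ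
  have hL := h.memLp_annealed h₀ h₁ hβ
  have key := (tendsto_integral_abs_sum _ (memLp_sub_prod hL)
    (integral_sub_prod (hL.integrable (by norm_num)))).div_const 2
  rw [integral_sub_sq_prod hL] at key
  have hval : √(2 * variance (energy p₀ p) (annealed ν p₀ p β)) * √(2 / Real.pi) / 2
      = (√Real.pi)⁻¹ * energyStd ν p₀ p β := by
    have h3 : √2 * √2 = (2 : ℝ) := Real.mul_self_sqrt (by norm_num)
    rw [energyStd, Real.sqrt_mul zero_le_two, Real.sqrt_div zero_le_two]
    linear_combination (√(variance (energy p₀ p) (annealed ν p₀ p β)) * (√Real.pi)⁻¹ / 2) * h3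
  rw [hval] at key
  refine key.congr fun d => ?_
  rw [h.localBarrierDim_eq d hβ, mul_div_assoc]

lemma continuousOn_localBarrierDim (h : IsIntegrablePair ν p₀ p) (d : ℕ) :
    ContinuousOn (localBarrierDim ν p₀ p d) (Icc 0 1) :=
  (h.prod d).continuousOn_localBarrier

lemma tendsto_inv_sqrt_mul_globalBarrierDim (h : IsIntegrablePair ν p₀ p)
    (h₀ : MemLp (energy p₀ p) 2 (densityMeasure ν p₀))
    (h₁ : MemLp (energy p₀ p) 2 (densityMeasure ν p)) :
    Tendsto (fun d : ℕ => (√d)⁻¹ * globalBarrierDim ν p₀ p d) atTop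
      (𝓝 ((√Real.pi)⁻¹ * ∫ β in (0 : ℝ)..1, energyStd ν p₀ p β)) := by
  have hsub : uIoc (0 : ℝ) 1 ⊆ Icc 0 1 := by
    rw [uIoc_of_le zero_le_one]; exact Ioc_subset_Icc_self
  have hσ := (h.continuousOn_energyStd h₀ h₁).intervalIntegrable_of_Icc (μ := volume) zero_le_one
  have heq : ∀ d : ℕ, (√d)⁻¹ * globalBarrierDim ν p₀ p d
      = ∫ β in (0 : ℝ)..1, (√d)⁻¹ * localBarrierDim ν p₀ p d β := fun d =>
    (intervalIntegral.integral_const_mul _ _).symm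
  simp_rw [heq]
  rw [← intervalIntegral.integral_const_mul]
  refine intervalIntegral.tendsto_integral_filter_of_dominated_convergence
    (energyStd ν p₀ p) ?_ ?_ hσ ?_
  · refine Eventually.of_forall fun d => ?_
    have := (((h.continuousOn_localBarrierDim d).intervalIntegrable_of_Icc (μ := volume)
      zero_le_one).const_mul (√d)⁻¹).aestronglyMeasurable
    rwa [uIoc_of_le zero_le_one]
  · refine Eventually.of_forall fun d => ae_of_all _ fun β hβ => ?_
    have hn := h.localBarrierDim_nonneg d (hsub hβ)
    rw [Real.norm_eq_abs, abs_of_nonneg (mul_nonneg (inv_nonneg.2 (Real.sqrt_nonneg _)) hn)]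
    refine (mul_le_mul_of_nonneg_left (h.localBarrierDim_le h₀ h₁ d (hsub hβ))
      (inv_nonneg.2 (Real.sqrt_nonneg _))).trans ?_
    rw [← mul_assoc]
    exact mul_le_of_le_one_left (Real.sqrt_nonneg _) inv_mul_le_one
  · exact ae_of_all _ fun β hβ => h.tendsto_inv_sqrt_mul_localBarrierDim h₀ h₁ (hsub hβ)

end IsIntegrablePair

/-! ### From rescaled limits to asymptotic relations -/

section Asymptotics

variable {a : ℕ → ℝ} {s : ℝ}

lemma sqrt_div_pi_mul (d : ℕ) (s : ℝ) : √(d / Real.pi) * s = √d * ((√Real.pi)⁻¹ * s) := by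
  rw [Real.sqrt_div (Nat.cast_nonneg d)]
  ring

lemma isLittleO_sqrt_of_tendsto
    (h : Tendsto (fun d : ℕ => (√d)⁻¹ * a d) atTop (𝓝 ((√Real.pi)⁻¹ * s))) :
    (fun d : ℕ => a d - √(d / Real.pi) * s) =o[atTop] (fun d : ℕ => √d) := by
  have hne : ∀ᶠ d : ℕ in atTop, √(d : ℝ) ≠ 0 := by
    filter_upwards [eventually_gt_atTop 0] with d hd
    exact (Real.sqrt_pos.2 (Nat.cast_pos.2 hd)).ne'
  rw [isLittleO_iff_tendsto' (hne.mono fun d hd h0 => absurd h0 hd)]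
  have := h.sub_const ((√Real.pi)⁻¹ * s)
  rw [sub_self] at this
  refine this.congr' (hne.mono fun d hd => ?_)
  simp only [sqrt_div_pi_mul]
  field_simp

lemma isTheta_sqrt_div_pi_mul (hs : s ≠ 0) :
    (fun d : ℕ => √(d / Real.pi) * s) =Θ[atTop] (fun d : ℕ => √(d : ℝ)) := by
  simp_rw [sqrt_div_pi_mul, mul_comm (√(_ : ℝ)) ((√Real.pi)⁻¹ * s)]
  exact (isTheta_refl _ _).const_mul_left
    (mul_ne_zero (inv_ne_zero (Real.sqrt_pos.2 Real.pi_pos).ne') hs)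

/-- In the degenerate case `s = 0` the rescaled limit does not suffice: the sequence itself has to
vanish. -/
lemma isEquivalent_of_tendsto
    (h : Tendsto (fun d : ℕ => (√d)⁻¹ * a d) atTop (𝓝 ((√Real.pi)⁻¹ * s)))
    (h0 : s = 0 → ∀ d, a d = 0) :
    a ~[atTop] (fun d : ℕ => √(d / Real.pi) * s) := by
  by_cases hs : s = 0
  · have ha : a = fun _ => 0 := funext (h0 hs)
    simp only [ha, hs, mul_zero]
    exact IsEquivalent.refl
  · exact (isLittleO_sqrt_of_tendsto h).trans_isTheta (isTheta_sqrt_div_pi_mul hs).symm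

lemma isBigO_sqrt_of_tendsto
    (h : Tendsto (fun d : ℕ => (√d)⁻¹ * a d) atTop (𝓝 ((√Real.pi)⁻¹ * s))) :
    a =O[atTop] (fun d : ℕ => √(d : ℝ)) := by
  have h1 : (fun d : ℕ => √(d / Real.pi) * s) =O[atTop] (fun d : ℕ => √(d : ℝ)) := by
    simp_rw [sqrt_div_pi_mul, mul_comm (√(_ : ℝ)) ((√Real.pi)⁻¹ * s)]
    exact isBigO_const_mul_self _ _ _
  simpa using (isLittleO_sqrt_of_tendsto h).isBigO.add h1

lemma isTheta_sqrt_of_tendsto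
    (h : Tendsto (fun d : ℕ => (√d)⁻¹ * a d) atTop (𝓝 ((√Real.pi)⁻¹ * s))) (hs : s ≠ 0) :
    a =Θ[atTop] (fun d : ℕ => √(d : ℝ)) :=
  (isEquivalent_of_tendsto h fun h0 => absurd h0 hs).isTheta.trans (isTheta_sqrt_div_pi_mul hs)

end Asymptotics

end Tempering

theorem mainTheorem7 {X : Type*} [MeasurableSpace X] (ν : Measure X) [SigmaFinite ν]
    (p₀ p : X → ℝ) (hp₀_meas : Measurable p₀) (hp_meas : Measurable p)
    (hp₀_pos : ∀ x, 0 < p₀ x) (hp_pos : ∀ x, 0 < p x)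
    (hp₀_prob : IsProbabilityMeasure (Tempering.densityMeasure ν p₀))
    (hp_prob : IsProbabilityMeasure (Tempering.densityMeasure ν p))
    (hV₀ : Integrable (fun x => Tempering.energy p₀ p x ^ 3) (Tempering.densityMeasure ν p₀))
    (hV : Integrable (fun x => Tempering.energy p₀ p x ^ 3) (Tempering.densityMeasure ν p)) :
    -- the quantities in the claim are well defined
    (∀ d : ℕ, ∀ β ∈ Icc (0 : ℝ) 1,
      Tendsto (fun δ : ℝ => Tempering.rejectionProb (Tempering.prodBase ν d)
          (Tempering.prodDensity p₀ d) (Tempering.prodDensity p d) β (β + δ) / |δ|)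
        (Tempering.increments β) (𝓝 (Tempering.localBarrierDim ν p₀ p d β))) ∧
    (∀ d : ℕ, IntervalIntegrable (Tempering.localBarrierDim ν p₀ p d) volume 0 1) ∧
    (∀ β ∈ Icc (0 : ℝ) 1, MemLp (Tempering.energy p₀ p) 2 (Tempering.annealed ν p₀ p β)) ∧
    IntervalIntegrable (Tempering.energyStd ν p₀ p) volume 0 1 ∧
    -- the asymptotic equivalences
    (∀ β ∈ Icc (0 : ℝ) 1,
      (fun d : ℕ => Tempering.localBarrierDim ν p₀ p d β) ~[atTop]
        (fun d : ℕ => Real.sqrt (d / Real.pi) * Tempering.energyStd ν p₀ p β)) ∧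
    (fun d : ℕ => Tempering.globalBarrierDim ν p₀ p d) ~[atTop]
      (fun d : ℕ => Real.sqrt (d / Real.pi) *
        ∫ β in (0 : ℝ)..1, Tempering.energyStd ν p₀ p β) ∧
    -- growth at rate `√d`
    (∀ β ∈ Icc (0 : ℝ) 1,
      (fun d : ℕ => Tempering.localBarrierDim ν p₀ p d β) =O[atTop]
        (fun d : ℕ => Real.sqrt d)) ∧
    (fun d : ℕ => Tempering.globalBarrierDim ν p₀ p d) =O[atTop] (fun d : ℕ => Real.sqrt d) ∧
    (Tempering.densityMeasure ν p₀ ≠ Tempering.densityMeasure ν p →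
      (∀ β ∈ Icc (0 : ℝ) 1,
        (fun d : ℕ => Tempering.localBarrierDim ν p₀ p d β) =Θ[atTop]
          (fun d : ℕ => Real.sqrt d)) ∧
      (fun d : ℕ => Tempering.globalBarrierDim ν p₀ p d) =Θ[atTop]
        (fun d : ℕ => Real.sqrt d)) := by
  have hm := Tempering.measurable_energy hp₀_meas hp_meas
  have h₀ := Tempering.memLp_two_of_integrable_pow_three hm hV₀
  have h₁ := Tempering.memLp_two_of_integrable_pow_three hm hV
  have h : Tempering.IsIntegrablePair ν p₀ p :=
    ⟨hp₀_meas, hp_meas, hp₀_pos, hp_pos, hp₀_prob, hp_prob, h₀.integrable (by norm_num),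
      h₁.integrable (by norm_num)⟩
  have hσ := h.continuousOn_energyStd h₀ h₁
  have hσ_int : IntervalIntegrable (Tempering.energyStd ν p₀ p) volume 0 1 :=
    hσ.intervalIntegrable_of_Icc zero_le_one
  have hσ_nonneg : ∀ β, 0 ≤ Tempering.energyStd ν p₀ p β := fun β => Real.sqrt_nonneg _
  have hloc := fun β (hβ : β ∈ Icc (0 : ℝ) 1) => h.tendsto_inv_sqrt_mul_localBarrierDim h₀ h₁ hβ
  have hglob := h.tendsto_inv_sqrt_mul_globalBarrierDim h₀ h₁
  have hint : ∀ d : ℕ, IntervalIntegrable (Tempering.localBarrierDim ν p₀ p d) volume 0 1 :=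
    fun d => (h.continuousOn_localBarrierDim d).intervalIntegrable_of_Icc zero_le_one
  refine ⟨fun d β hβ => ?_, hint, fun β hβ => h.memLp_annealed h₀ h₁ hβ, hσ_int,
    fun β hβ => Tempering.isEquivalent_of_tendsto (hloc β hβ) fun h0 d => ?_,
    Tempering.isEquivalent_of_tendsto hglob fun h0 d => ?_,
    fun β hβ => Tempering.isBigO_sqrt_of_tendsto (hloc β hβ),
    Tempering.isBigO_sqrt_of_tendsto hglob, fun hne => ⟨fun β hβ => ?_, ?_⟩⟩
  · rw [Tempering.localBarrierDim, (h.prod d).localBarrier_eq hβ]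
    exact (h.prod d).tendsto_rejectionProb_div hβ
  · refine le_antisymm ?_ (h.localBarrierDim_nonneg d hβ)
    simpa [h0] using h.localBarrierDim_le h₀ h₁ d hβ
  · refine le_antisymm ?_ (intervalIntegral.integral_nonneg zero_le_one
      fun β hβ => h.localBarrierDim_nonneg d hβ)
    calc Tempering.globalBarrierDim ν p₀ p d
        ≤ ∫ β in (0 : ℝ)..1, √d * Tempering.energyStd ν p₀ p β :=
          intervalIntegral.integral_mono_on zero_le_one (hint d) (hσ_int.const_mul _)
            fun β hβ => h.localBarrierDim_le h₀ h₁ d hβ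
      _ = 0 := by rw [intervalIntegral.integral_const_mul, h0, mul_zero]
  · exact Tempering.isTheta_sqrt_of_tendsto (hloc β hβ) (h.energyStd_pos h₀ h₁ hne hβ).ne'
  · refine Tempering.isTheta_sqrt_of_tendsto hglob (ne_of_gt ?_)
    exact intervalIntegral.intervalIntegral_pos_of_pos_on hσ_int
      (fun β hβ => h.energyStd_pos h₀ h₁ hne (Ioo_subset_Icc_self hβ)) zero_lt_one
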